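/- Let $s$ be an indeterminate, and put $\{n\}_s=s^n-s^{-n}$ and $[n]_s=\{n\}_s/\{1\}_s$ for an integer $n$. Let $V_H(m,n)\in\mathbb{Q}(s)$ be the colored Jones polynomial of the zero-framed Hopf link $H$ whose components are colored by the $m$- and the $n$-dimensional simple $U_q(\mathfrak{sl}_2)$-modules ($q=s^2$), normalized so that a $k$-component unlink with colors $n_1,\dots,n_k$ has the value $[n_1]_s\cdots[n_k]_s$; color $0$ means the zero module. Consider the algebra of noncommutative polynomials in $E_m,E_n$ whose coefficients are Laurent polynomials in $Q_m,Q_n$ over $\mathbb{Q}(s)$, with the relations $$E_mE_n=E_nE_m,\quad E_mQ_m=sQ_mE_m,\quad E_nQ_n=sQ_nE_n,\quad E_mQ_n=Q_nE_m,\quad E_nQ_m=Q_mE_n.$$ It acts on functions $V$ of $(m,n)\in\mathbb{Z}_{\ge 0}^2$ with values in $\mathbb{Q}(s)$ by $(E_mV)(m,n)=V(m+1,n)$, $(E_nV)(m,n)=V(m,n+1)$, $(Q_mV)(m,n)=s^mV(m,n)$, $(Q_nV)(m,n)=s^nV(m,n)$. For an invertible coefficient $x$ let $a(x)=x-x^{-1}$,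 and put $$A_{s;m}(H)=E_m^2-(Q_n+Q_n^{-1})E_m+1,\qquad A_{s;n}(H)=E_n^2-(Q_m+Q_m^{-1})E_n+1,$$ $$A^{\mathrm{bi}}_{s;mn}(H)=a(Q_m)E_m-a(Q_n)E_n+a(Q_nQ_m^{-1}).$$ Then $V_H(m,n)=[mn]_s$ for all $m,n\ge 0$; each of $A_{s;m}(H)$, $A_{s;n}(H)$ and $A^{\mathrm{bi}}_{s;mn}(H)$ annihilates $V_H$; and in the algebra $$a(Q_m)a(sQ_m)A_{s;m}(H)-a(Q_n)a(sQ_n)A_{s;n}(H)=\{a(Q_m)E_m+a(Q_n)E_n-a(sQ_mQ_n)\}\,A^{\mathrm{bi}}_{s;mn}(H).$$ -/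

import Mathlib

noncomputable section

namespace HopfAJ

/-! ### The ground field and quantum integers -/

/-- The field `ℚ(s)`. -/
abbrev K : Type := RatFunc ℚ

/-- The variable `s = q^{1/2}`. -/
def s : K := RatFunc.X

theorem s_ne_zero : s ≠ 0 := RatFunc.X_ne_zero

/-- `{n}_s = s^n - s^{-n}`. -/
def brace (n : ℤ) : K := s ^ n - s ^ (-n)

/-- `[n]_s = {n}_s / {1}_s`. -/
def qint (n : ℤ) : K := brace n / brace 1

/-- `[k]_s! = [1]_s [2]_s ⋯ [k]_s`. -/
def qfact (k : ℕ) : K := ∏ l ∈ Finset.range k, qint (l + 1)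

/-! ### The colored Jones polynomial of the closure of a colored braid

The color `n` stands for the simple `n`-dimensional module `V_n` of `U_q(sl_2)` with basis
`e_0, …, e_{n-1}` and, with `e_{-1} = e_n = 0`,
`H e_i = (n-1-2i) e_i`, `E e_i = [n-i] e_{i-1}`, `F e_i = [i+1] e_{i+1}`. The braiding is
`P ∘ R` for the universal R-matrix
`R = s^{H ⊗ H / 2} ∑_k s^{k(k-1)/2} ({1}^k / [k]!) E^k ⊗ F^k`, whose inverse is
`R⁻¹ = (∑_k (-1)^k s^{-k(k-1)/2} ({1}^k / [k]!) E^k ⊗ F^k) s^{-H ⊗ H / 2}`. -/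

/-- The coefficient of `e_{i-k}` in `E^k e_i`, for the module `V_n` (and `k ≤ i`). -/
def coeffE (n i k : ℕ) : K := ∏ l ∈ Finset.range k, qint ((n : ℤ) - i + l)

/-- The coefficient of `e_{j+k}` in `F^k e_j` (if `j + k` is less than the dimension). -/
def coeffF (j k : ℕ) : K := ∏ l ∈ Finset.range k, qint ((j : ℤ) + 1 + l)

/-- The matrix coefficient from `e_i ⊗ e_j ∈ V_m ⊗ V_n` to `e_p ⊗ e_q ∈ V_n ⊗ V_m` (so `p < n`
and `q < m`) of the braiding `V_m ⊗ V_n → V_n ⊗ V_m`, multiplied by `s^{-(m-1)(n-1)/2}` in order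
to avoid fractional powers of `s`. -/
def posCrossing (m n i j p q : ℕ) : K :=
  if p + q = i + j ∧ q ≤ i then
    s ^ (2 * (p : ℤ) * q - p * ((m : ℤ) - 1) - q * ((n : ℤ) - 1)) *
      (s ^ (i - q).choose 2 * brace 1 ^ (i - q) / qfact (i - q)) *
      (coeffE m i (i - q) * coeffF j (i - q))
  else 0

/-- The matrix coefficient from `e_i ⊗ e_j ∈ V_m ⊗ V_n` to `e_p ⊗ e_q ∈ V_n ⊗ V_m` of the inverse
of the braiding `V_n ⊗ V_m → V_m ⊗ V_n`, multiplied by `s^{(m-1)(n-1)/2}`. -/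
def negCrossing (m n i j p q : ℕ) : K :=
  if p + q = i + j ∧ p ≤ j then
    s ^ (-(2 * (i : ℤ) * j - i * ((n : ℤ) - 1) - j * ((m : ℤ) - 1))) *
      ((-1) ^ (j - p) * (s ^ (j - p).choose 2)⁻¹ * brace 1 ^ (j - p) / qfact (j - p)) *
      (coeffE n j (j - p) * coeffF i (j - p))
  else 0

/-- The coefficient at a crossing: the braiding for `true`, the inverse braiding for `false`. -/
def crossing (ε : Bool) (m n i j p q : ℕ) : K :=
  if ε then posCrossing m n i j p q else negCrossing m n i j p q

/-- A braid word on `d + 1` strands. The letter `(i, ε)` is the generator `σ_i` (or its inverse, if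
`ε = false`), which crosses the strands in the positions `i` and `i + 1`. -/
abbrev BraidWord (d : ℕ) : Type := List (Fin d × Bool)

section

variable {ι : Type*} [DecidableEq ι] {d : ℕ}

/-- The labels of the strands after the `i`-th and the `(i+1)`-st strand are interchanged. -/
def swapLabels (i : Fin d) (lab : Fin (d + 1) → ι) : Fin (d + 1) → ι :=
  lab ∘ Equiv.swap i.castSucc i.succ

/-- The matrix coefficient from the basis vector `x` to the basis vector `y` of the operator of a
braid word, whose strand in position `i` at the start is part of the link component `lab i`; the
component `t` has the color `c t`. -/
def amplitude (c : ι → ℕ) :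
    BraidWord d → (Fin (d + 1) → ι) → (Fin (d + 1) → ℕ) → (Fin (d + 1) → ℕ) → K
  | [], _, x, y => if x = y then 1 else 0
  | (i, ε) :: w, lab, x, y =>
    ∑ p ∈ Finset.range (c (lab i.succ)), ∑ q ∈ Finset.range (c (lab i.castSucc)),
      crossing ε (c (lab i.castSucc)) (c (lab i.succ)) (x i.castSucc) (x i.succ) p q *
        amplitude c w (swapLabels i lab)
          (Function.update (Function.update x i.castSucc p) i.succ q) y

/-- Twice the exponent of `s` by which the state sum has to be corrected: a crossing of the colors
`m`, `n` with sign `ε` contributes `ε (m-1)(n-1)`, which undoes the normalization of the crossing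
coefficients, and a self-crossing of a component of color `n` contributes `-ε (n²-1)` in addition,
which changes the blackboard framing to the zero framing. -/
def twiceExponent (c : ι → ℕ) : BraidWord d → (Fin (d + 1) → ι) → ℤ
  | [], _ => 0
  | (i, ε) :: w, lab =>
    (if ε then 1 else -1) *
      (((c (lab i.castSucc) : ℤ) - 1) * ((c (lab i.succ) : ℤ) - 1) -
        (if lab i.castSucc = lab i.succ then (c (lab i.succ) : ℤ) ^ 2 - 1 else 0)) +
      twiceExponent c w (swapLabels i lab)

/-- The colored Jones polynomial of the (zero-framed) closure of a braid word: the quantum trace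
(the trace weighted by `s^H` on every strand) of the operator of the braid. It is normalized so
that an unlink has the value `∏ [n_i]_s`. Here `lab` assigns to each strand the component of the
closure to which it belongs, and `c` assigns to each component its color. The sum of the
contributions in `twiceExponent` is even. -/
def coloredJones (w : BraidWord d) (lab : Fin (d + 1) → ι) (c : ι → ℕ) : K :=
  s ^ (twiceExponent c w lab / 2) *
    ∑ x ∈ Fintype.piFinset (fun i => Finset.range (c (lab i))),
      (∏ i, s ^ ((c (lab i) : ℤ) - 1 - 2 * x i)) * amplitude c w lab x x

end

/-- The colored Jones polynomial `V_H(m, n)` of the Hopf link `H`, the closure of `σ₁²`, whose two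
components have the colors `m` and `n`. The color `0` stands for the zero module. -/
def VH (m n : ℕ) : K :=
  coloredJones (d := 1) [(0, true), (0, true)] (id : Fin 2 → Fin 2) ![m, n]

/-! ### The algebra of `s`-difference operators in two variables -/

/-- The coefficients: Laurent polynomials in `Q_m`, `Q_n` over `ℚ(s)`. The exponent `(a, b)` stands
for the monomial `Q_m^a Q_n^b`. -/
abbrev Coeff : Type := AddMonoidAlgebra K (ℤ × ℤ)

/-- The invertible element `u Q_m^a Q_n^b`, for `u ≠ 0` in `ℚ(s)`. -/
def monomialUnit (u : K) (hu : u ≠ 0) (v : ℤ × ℤ) : Coeffˣ where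
  val := AddMonoidAlgebra.single v u
  inv := AddMonoidAlgebra.single (-v) u⁻¹
  val_inv := by
    rw [AddMonoidAlgebra.single_mul_single, add_neg_cancel, mul_inv_cancel₀ hu]; rfl
  inv_val := by
    rw [AddMonoidAlgebra.single_mul_single, neg_add_cancel, inv_mul_cancel₀ hu]; rfl

/-- The scalar `s`. -/
def sU : Coeffˣ := monomialUnit s s_ne_zero 0

/-- The variable `Q_m`. -/
def Qm : Coeffˣ := monomialUnit 1 one_ne_zero (1, 0)

/-- The variable `Q_n`. -/
def Qn : Coeffˣ := monomialUnit 1 one_ne_zero (0, 1)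

/-- The substitution `p(Q_m, Q_n) ↦ p(s^j Q_m, s^k Q_n)`. -/
def shift (j k : ℕ) : Coeff →ₐ[K] Coeff :=
  AddMonoidAlgebra.lift K Coeff (ℤ × ℤ)
    { toFun := fun v => AddMonoidAlgebra.single v.toAdd (s ^ (j * v.toAdd.1 + k * v.toAdd.2))
      map_one' := by simp [AddMonoidAlgebra.one_def]
      map_mul' := fun v w => by
        rw [AddMonoidAlgebra.single_mul_single, ← zpow_add₀ s_ne_zero, toAdd_mul, Prod.fst_add,
          Prod.snd_add]
        congr 2
        ring }

theorem shift_single (j k : ℕ) (v : ℤ × ℤ) (u : K) :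
    shift j k (AddMonoidAlgebra.single v u) =
      AddMonoidAlgebra.single v (u * s ^ (j * v.1 + k * v.2)) := by
  simp [shift, AddMonoidAlgebra.lift_single]

/-- The monoid of monomials `E_m^j E_n^k`, written as pairs `(j, k)`. -/
abbrev ShiftMonoid : Type := Multiplicative (ℕ × ℕ)

instance : MulSemiringAction ShiftMonoid Coeff where
  smul g p := shift g.toAdd.1 g.toAdd.2 p
  one_smul p := by
    change shift 0 0 p = p
    induction p using AddMonoidAlgebra.induction_linear with
    | zero => simp
    | add f g hf hg => rw [map_add, hf, hg]
    | single v u => simp [shift_single]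
  mul_smul g h p := by
    change shift (g.toAdd.1 + h.toAdd.1) (g.toAdd.2 + h.toAdd.2) p =
      shift g.toAdd.1 g.toAdd.2 (shift h.toAdd.1 h.toAdd.2 p)
    induction p using AddMonoidAlgebra.induction_linear with
    | zero => simp
    | add f g hf hg => simp only [map_add, hf, hg]
    | single v u =>
      simp only [shift_single]
      rw [mul_assoc, ← zpow_add₀ s_ne_zero]
      congr 3
      push_cast
      ring
  smul_zero g := map_zero (shift g.toAdd.1 g.toAdd.2)
  smul_add g := map_add (shift g.toAdd.1 g.toAdd.2)
  smul_one g := map_one (shift g.toAdd.1 g.toAdd.2)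
  smul_mul g := map_mul (shift g.toAdd.1 g.toAdd.2)

/-- The algebra of noncommutative polynomials `∑ c_{jk}(s, Q_m, Q_n) E_m^j E_n^k` with the relations
`E_m^j E_n^k p(Q_m, Q_n) = p(s^j Q_m, s^k Q_n) E_m^j E_n^k`. -/
abbrev QAlg : Type := SkewMonoidAlgebra Coeff ShiftMonoid

/-- A coefficient as an element of the algebra. -/
def ofCoeff (p : Coeff) : QAlg := SkewMonoidAlgebra.single 1 p

/-- The variable `E_m`. -/
def Em : QAlg := SkewMonoidAlgebra.single (Multiplicative.ofAdd (1, 0)) 1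

/-- The variable `E_n`. -/
def En : QAlg := SkewMonoidAlgebra.single (Multiplicative.ofAdd (0, 1)) 1

/-- The evaluation of a coefficient at `Q_m = s^m`, `Q_n = s^n`. -/
def evalCoeff (m n : ℕ) : Coeff →ₐ[K] K :=
  AddMonoidAlgebra.lift K K (ℤ × ℤ)
    { toFun := fun v => s ^ ((m : ℤ) * v.toAdd.1 + n * v.toAdd.2)
      map_one' := by simp
      map_mul' := fun v w => by
        rw [← zpow_add₀ s_ne_zero, toAdd_mul, Prod.fst_add, Prod.snd_add]
        congr 1
        ring }

/-- The action of a noncommutative polynomial on discrete functions, determined by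
`(E_m V)(m, n) = V(m+1, n)`, `(E_n V)(m, n) = V(m, n+1)`, `(Q_m V)(m, n) = s^m V(m, n)` and
`(Q_n V)(m, n) = s^n V(m, n)`. -/
def act (P : QAlg) (V : ℕ → ℕ → K) : ℕ → ℕ → K := fun m n =>
  P.sum fun g c => evalCoeff m n c * V (m + g.toAdd.1) (n + g.toAdd.2)

/-! ### The polynomials of the Hopf link -/

/-- `a(x) = x - x⁻¹`. -/
def a (x : Coeffˣ) : QAlg := ofCoeff ((x : Coeff) - ((x⁻¹ : Coeffˣ) : Coeff))

/-- `A_{s;m}(H) = E_m² - (Q_n + Q_n⁻¹) E_m + 1`. -/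
def AHm : QAlg := Em ^ 2 - ofCoeff ((Qn : Coeff) + ((Qn⁻¹ : Coeffˣ) : Coeff)) * Em + 1

/-- `A_{s;n}(H) = E_n² - (Q_m + Q_m⁻¹) E_n + 1`. -/
def AHn : QAlg := En ^ 2 - ofCoeff ((Qm : Coeff) + ((Qm⁻¹ : Coeffˣ) : Coeff)) * En + 1

/-- `A^bi_{s;mn}(H) = a(Q_m) E_m - a(Q_n) E_n + a(Q_n Q_m⁻¹)`. -/
def AHbi : QAlg := a Qm * Em - a Qn * En + a (Qn * Qm⁻¹)

end HopfAJ

end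

/-!
The value of the Hopf link. Write `n = N + 1`. The partial trace of the double braiding over
`V_n`, taken at the basis vector `e_i` of `V_m`, is
`T_N(i) = ∑_{j+k+r=N} s^{(m-2i+k)(r-j)} [j+k choose k] [r+k choose k] ∏_{l<k} {m-i+l} {i-l}`
(`posCrossing_mul_posCrossing`, `sum_posCrossing`). It has to be independent of `i`, since it is
the action of a central element on a simple module. Here this is proved by a generating function
in `N`. Put `D_l = 1 - (s^{m-2i+2l} + s^{-(m-2i+2l)}) X + X²` and
`D = 1 - (s^m + s^{-m}) X + X²`. The `q`-binomial theorem turns the sum over `j` and `r` into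
`∏_{l≤k} D_l⁻¹` (`pairSeries_succ_mul`), and `X {m-i+l} {i-l} = D_l - D` (`quad_sub_quad`).
Hence `∑_N T_N(i) X^N = ∑_k ∏_{l<k} (D_l - D) / ∏_{l≤k} D_l`, which telescopes to `1 / D`, because
`D_i = D` (`sum_weight_pairSeries`). So `T_N(i)` is the coefficient
`∑_{j+r=N} s^{m(r-j)} = [mn] / [m]` of `1 / D`, and the remaining trace over `V_m` multiplies it
by `[m]` (`sum_mul_coeff_pairSeries`).

The three operators annihilate `[mn]` by identities between Laurent monomials in `s^m`, `s^n` and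
`s^{mn}`. For the identity in the algebra both sides are expanded into the monomials
`E_m^j E_n^k` with coefficients on the left; the coefficients agree by
`aCoeff_mul_add_inv` and `aCoeff_mul_sub_aCoeff_mul`.
-/

noncomputable section

namespace HopfAJ

open PowerSeries

/-! ### Quantum integers -/

theorem intDegree_s_zpow (n : ℤ) : (s ^ n).intDegree = n := by
  have h (k : ℕ) : (s ^ k).intDegree = k := by
    induction k with
    | zero => simp
    | succ k ih =>
      rw [pow_succ, RatFunc.intDegree_mul (pow_ne_zero _ s_ne_zero) s_ne_zero, ih, s,
        RatFunc.intDegree_X]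
      simp
  obtain ⟨k, rfl | rfl⟩ := n.eq_nat_or_neg
  · rw [zpow_natCast, h]
  · rw [zpow_neg, zpow_natCast, RatFunc.intDegree_inv, h]

theorem brace_ne_zero {n : ℤ} (hn : n ≠ 0) : brace n ≠ 0 := fun h => by
  have := congrArg RatFunc.intDegree (sub_eq_zero.1 h)
  rw [intDegree_s_zpow, intDegree_s_zpow] at this
  omega

theorem brace_one_ne_zero : brace 1 ≠ 0 := brace_ne_zero one_ne_zero

theorem qint_ne_zero {n : ℤ} (hn : n ≠ 0) : qint n ≠ 0 :=
  div_ne_zero (brace_ne_zero hn) brace_one_ne_zero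

theorem brace_one_mul_qint (n : ℤ) : brace 1 * qint n = brace n := by
  rw [qint, mul_div_cancel₀ _ brace_one_ne_zero]

theorem qfact_ne_zero (k : ℕ) : qfact k ≠ 0 := by
  refine Finset.prod_ne_zero_iff.2 fun l _ => ?_
  exact qint_ne_zero (by positivity)

/-! ### Generating functions of quantum binomial coefficients -/

/-- The symmetric quantum binomial coefficient `[j+k choose k] = [j+1] ⋯ [j+k] / [k]!`. Note that
the upper entry is `j + k`, so that `qbinom k` is a sequence starting with the value `1` at `0`. -/
def qbinom (k j : ℕ) : K := coeffF j k / qfact k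

theorem qbinom_zero_left (j : ℕ) : qbinom 0 j = 1 := by simp [qbinom, coeffF, qfact]

theorem qbinom_zero_right (k : ℕ) : qbinom k 0 = 1 := by
  have : coeffF 0 k = qfact k := by simp [coeffF, qfact, add_comm]
  rw [qbinom, this, div_self (qfact_ne_zero k)]

/-- The two addition formulas for quantum integers, which are exchanged by `s ↦ s⁻¹`. -/
theorem qint_add (e : ℤ) (he : e = 1 ∨ e = -1) (x y : ℤ) :
    qint (x + y) = s ^ (e * x) * qint y + s ^ (-(e * y)) * qint x := by
  have hs := s_ne_zero
  rcases he with rfl | rfl <;>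
  · simp only [qint, brace, one_mul, neg_mul, neg_neg, neg_add, zpow_add₀ hs, zpow_neg]
    ring

/-- The two quantum Pascal rules, one for each sign `e`. -/
theorem qbinom_pascal (e : ℤ) (he : e = 1 ∨ e = -1) (k j : ℕ) :
    qbinom (k + 1) (j + 1) - s ^ (-(e * (k + 1))) * qbinom (k + 1) j =
      s ^ (e * (j + 1)) * qbinom k (j + 1) := by
  have h1 : coeffF (j + 1) (k + 1) = coeffF (j + 1) k * qint ((j + 1) + (k + 1)) := by
    rw [coeffF, Finset.prod_range_succ, ← coeffF]
    congr 2; push_cast; ring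
  have h2 : coeffF j (k + 1) = coeffF (j + 1) k * qint (j + 1) := by
    rw [coeffF, Finset.prod_range_succ', coeffF]
    congr 1
    refine Finset.prod_congr rfl fun l _ => ?_
    congr 1; push_cast; ring
  have h3 : qfact (k + 1) = qfact k * qint (k + 1) := by
    rw [qfact, Finset.prod_range_succ, ← qfact]
  have h4 : qint (k + 1) ≠ 0 := qint_ne_zero (by positivity)
  have h5 := qfact_ne_zero k
  rw [qbinom, qbinom, qbinom, h1, h2, h3, qint_add e he]
  field_simp
  ring

/-- The power series `∑_j s^{-e(w+k)j} [j+k choose k] X^j`, for a sign `e`. It is the inverse of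
`∏_{l ≤ k} (1 - s^{-e(w+2l)} X)`. -/
def qbinomSeries (e w : ℤ) (k : ℕ) : K⟦X⟧ :=
  PowerSeries.mk fun j => s ^ (-(e * (w + k) * j)) * qbinom k j

theorem qbinomSeries_zero_mul (e w : ℤ) :
    qbinomSeries e w 0 * (1 - C (s ^ (-(e * w))) * X) = 1 := by
  ext j
  rw [mul_sub, mul_one, mul_left_comm, ← mul_assoc, mul_comm]
  rcases j with _ | j
  · simp [qbinomSeries, qbinom_zero_left]
  · rw [map_sub, mul_comm, coeff_succ_mul_X, coeff_C_mul]
    simp only [qbinomSeries, coeff_mk, qbinom_zero_left, coeff_one]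
    rw [mul_one, mul_one, ← zpow_add₀ s_ne_zero, if_neg (by simp), sub_eq_zero]
    congr 1; push_cast; ring

theorem qbinomSeries_succ_mul (e : ℤ) (he : e = 1 ∨ e = -1) (w : ℤ) (k : ℕ) :
    qbinomSeries e w (k + 1) * (1 - C (s ^ (-(e * (w + 2 * (k + 1))))) * X) =
      qbinomSeries e w k := by
  have hs := s_ne_zero
  ext j
  rw [mul_sub, mul_one, mul_left_comm, ← mul_assoc, mul_comm]
  rcases j with _ | j
  · simp [qbinomSeries, qbinom_zero_right]
  · rw [map_sub, mul_comm, coeff_succ_mul_X, coeff_C_mul]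
    simp only [qbinomSeries, coeff_mk]
    have h : s ^ (-(e * (w + (k : ℤ)) * ((j + 1 : ℕ) : ℤ))) =
        s ^ (-(e * (w + ((k + 1 : ℕ) : ℤ)) * ((j + 1 : ℕ) : ℤ))) * s ^ (e * (j + 1)) := by
      rw [← zpow_add₀ hs]; congr 1; push_cast; ring
    have h' : s ^ (-(e * (w + 2 * (k + 1)))) * s ^ (-(e * (w + ((k + 1 : ℕ) : ℤ)) * (j : ℤ))) =
        s ^ (-(e * (w + ((k + 1 : ℕ) : ℤ)) * ((j + 1 : ℕ) : ℤ))) * s ^ (-(e * (k + 1))) := by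
      rw [← zpow_add₀ hs, ← zpow_add₀ hs]; congr 1; push_cast; ring
    rw [h, mul_assoc _ _ (qbinom k _), ← qbinom_pascal e he, ← mul_assoc, h']
    ring

/-! ### The telescoping sum -/

/-- The polynomial `(1 - s^{-v} X) (1 - s^v X)`. -/
def quad (v : ℤ) : K⟦X⟧ := (1 - C (s ^ (-v)) * X) * (1 - C (s ^ v) * X)

/-- The factors `{m-i+l} {i-l}` that come from `E^k` and `F^k` measure the difference of two of the
quadratic polynomials; this is what makes the state sum telescope. -/
theorem quad_sub_quad (m i l : ℤ) :
    quad (m - 2 * i + 2 * l) - quad m = C (brace (m - i + l) * brace (i - l)) * X := by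
  have hs := s_ne_zero
  have h (v : ℤ) : quad v = 1 - C (s ^ v + s ^ (-v)) * X + X ^ 2 := by
    have : (C (s ^ (-v)) : K⟦X⟧) * C (s ^ v) = 1 := by
      rw [← map_mul, ← zpow_add₀ hs]; simp
    rw [quad, map_add]
    linear_combination X ^ 2 * this
  have h2 : brace (m - i + l) * brace (i - l) =
      (s ^ m + s ^ (-m)) - (s ^ (m - 2 * i + 2 * l) + s ^ (-(m - 2 * i + 2 * l))) := by
    simp only [brace, sub_mul, mul_sub, ← zpow_add₀ hs]
    rw [show m - i + l + (i - l) = m by ring, show -(m - i + l) + -(i - l) = -m by ring,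
      show m - i + l + -(i - l) = m - 2 * i + 2 * l by ring,
      show -(m - i + l) + (i - l) = -(m - 2 * i + 2 * l) by ring]
    ring
  rw [h, h, h2]
  simp only [map_sub]
  ring

/-- The inverse of `∏_{l ≤ k} quad (w + 2l)`, written as a product of two `q`-binomial series. -/
def pairSeries (w : ℤ) (k : ℕ) : K⟦X⟧ := qbinomSeries 1 w k * qbinomSeries (-1) w k

theorem pairSeries_zero_mul (w : ℤ) : pairSeries w 0 * quad w = 1 := by
  have h1 := qbinomSeries_zero_mul 1 w
  have h2 := qbinomSeries_zero_mul (-1) w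
  rw [one_mul] at h1
  rw [neg_one_mul, neg_neg] at h2
  rw [pairSeries, quad, mul_mul_mul_comm, h1, h2, one_mul]

theorem pairSeries_succ_mul (w : ℤ) (k : ℕ) :
    pairSeries w (k + 1) * quad (w + 2 * (k + 1)) = pairSeries w k := by
  have h1 := qbinomSeries_succ_mul 1 (.inl rfl) w k
  have h2 := qbinomSeries_succ_mul (-1) (.inr rfl) w k
  rw [one_mul] at h1
  rw [neg_one_mul, neg_neg] at h2
  rw [pairSeries, quad, mul_mul_mul_comm, h1, h2, pairSeries]

/-- The product `∏_{l < k} {m-i+l} {i-l}`, which is `{1}^{2k}` times the matrix coefficient of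
`F^k E^k` at the basis vector `e_i` of `V_m`. -/
def weight (m i : ℤ) (k : ℕ) : K :=
  ∏ l ∈ Finset.range k, brace (m - i + l) * brace (i - l)

/-- With `D_l = quad (m - 2i + 2l)` and `D = quad m`, the `l`-th summand is
`∏_{t < l} (1 - D / D_t) · D / D_l`, so that the sum telescopes. -/
theorem sum_weight_pairSeries_mul (m i : ℤ) (k : ℕ) :
    (∑ l ∈ Finset.range (k + 1), C (weight m i l) * X ^ l * pairSeries (m - 2 * i) l) * quad m =
      1 - C (weight m i (k + 1)) * X ^ (k + 1) * pairSeries (m - 2 * i) k := by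
  induction k with
  | zero =>
    have h := quad_sub_quad m i 0
    have h' := pairSeries_zero_mul (m - 2 * i)
    rw [mul_zero, add_zero] at h
    simp only [weight, zero_add, Finset.sum_range_one, Finset.prod_range_zero,
      Finset.prod_range_one, map_one, pow_zero, pow_one, Nat.cast_zero, one_mul]
    rw [← h]
    linear_combination h'
  | succ k ih =>
    have h := quad_sub_quad m i (k + 1 : ℕ)
    have h' := pairSeries_succ_mul (m - 2 * i) k
    have hw : weight m i (k + 1 + 1) = weight m i (k + 1) *
        (brace (m - i + (k + 1 : ℕ)) * brace (i - (k + 1 : ℕ))) := by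
      rw [weight, Finset.prod_range_succ, ← weight]
    rw [Finset.sum_range_succ, add_mul, ih, hw, map_mul, pow_succ X (k + 1)]
    push_cast at h ⊢
    linear_combination (C (weight m i (k + 1)) * X ^ (k + 1)) * h' -
      (C (weight m i (k + 1)) * X ^ (k + 1)) * pairSeries (m - 2 * i) (k + 1) * h

/-- The generating function of the partial traces at `e_i` does not depend on `i`: it is the
inverse of `quad m`. -/
theorem sum_weight_pairSeries (m : ℤ) (i : ℕ) :
    ∑ l ∈ Finset.range (i + 1), C (weight m i l) * X ^ l * pairSeries (m - 2 * i) l =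
      pairSeries m 0 := by
  have h := sum_weight_pairSeries_mul m i i
  -- The factor `{i - l}` vanishes at `l = i`, which ends the telescoping sum.
  have hw : weight m i (i + 1) = 0 := by
    rw [weight, Finset.prod_range_succ]; simp [brace]
  rw [hw, map_zero, zero_mul, zero_mul, sub_zero] at h
  calc _ = _ * (pairSeries m 0 * quad m) := by rw [pairSeries_zero_mul, mul_one]
    _ = _ := by rw [mul_left_comm, h, mul_one]

theorem coeff_pairSeries (w : ℤ) (k N : ℕ) :
    coeff N (pairSeries w k) = ∑ x ∈ Finset.HasAntidiagonal.antidiagonal N,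
      s ^ ((w + k) * ((x.2 : ℤ) - x.1)) * (qbinom k x.1 * qbinom k x.2) := by
  rw [pairSeries, coeff_mul]
  refine Finset.sum_congr rfl fun x _ => ?_
  rw [qbinomSeries, qbinomSeries, coeff_mk, coeff_mk, mul_mul_mul_comm, ← zpow_add₀ s_ne_zero]
  congr 2; ring

/-! ### Geometric sums -/

theorem sum_zpow_mul (t : K) (ht : t ≠ 0) (n : ℕ) :
    (∑ j ∈ Finset.range n, t ^ ((n : ℤ) - 1 - 2 * j)) * (t - t⁻¹) =
      t ^ (n : ℤ) - t ^ (-(n : ℤ)) := by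
  have h := Finset.sum_range_sub (fun j : ℕ => -t ^ ((n : ℤ) - 2 * j)) n
  rw [Finset.sum_mul]
  have e : (n : ℤ) - 2 * n = -n := by ring
  simp only [Nat.cast_zero, mul_zero, sub_zero, e] at h
  rw [show t ^ (n : ℤ) - t ^ (-(n : ℤ)) = -t ^ (-(n : ℤ)) - -t ^ (n : ℤ) by ring, ← h]
  refine Finset.sum_congr rfl fun j _ => ?_
  rw [mul_sub, ← zpow_add_one₀ ht, ← zpow_sub_one₀ ht]
  rw [show (n : ℤ) - 1 - 2 * j + 1 = n - 2 * j by ring,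
    show (n : ℤ) - 1 - 2 * j - 1 = n - 2 * (j + 1 : ℕ) by push_cast; ring]
  ring

theorem sum_mul_coeff_pairSeries (m N : ℕ) :
    (∑ i ∈ Finset.range m, s ^ ((m : ℤ) - 1 - 2 * i)) * coeff N (pairSeries m 0) =
      qint (m * (N + 1 : ℕ)) := by
  have h1 := sum_zpow_mul s s_ne_zero m
  have h2 := sum_zpow_mul (s ^ (m : ℤ)) (zpow_ne_zero _ s_ne_zero) (N + 1)
  have h3 : coeff N (pairSeries m 0) =
      ∑ j ∈ Finset.range (N + 1), (s ^ (m : ℤ)) ^ (((N + 1 : ℕ) : ℤ) - 1 - 2 * j) := by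
    rw [coeff_pairSeries, Finset.Nat.sum_antidiagonal_eq_sum_range_succ_mk]
    refine Finset.sum_congr rfl fun j hj => ?_
    have : j ≤ N := Nat.lt_succ_iff.1 (Finset.mem_range.1 hj)
    simp only [qbinom_zero_left, mul_one, ← zpow_mul]
    congr 1; push_cast [this]; ring
  have hb : brace 1 = s - s⁻¹ := by simp [brace]
  rw [h3, qint, eq_div_iff brace_one_ne_zero, hb, mul_right_comm, h1]
  rw [← zpow_neg] at h2
  rw [mul_comm, h2, brace, ← zpow_mul, ← zpow_mul, mul_neg]

/-! ### The state sum of the Hopf link -/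

/-- The state sum of the closure of `σ₁²`: the second crossing has to return to the initial
basis vector. -/
theorem VH_eq_sum (m n : ℕ) : VH m n =
    s ^ (((m : ℤ) - 1) * (n - 1)) * ∑ i ∈ Finset.range m, ∑ j ∈ Finset.range n,
      s ^ ((m : ℤ) - 1 - 2 * i) * s ^ ((n : ℤ) - 1 - 2 * j) *
        ∑ p ∈ Finset.range n, ∑ q ∈ Finset.range m,
          posCrossing m n i j p q * posCrossing n m p q i j := by
  have hexp : twiceExponent ![m, n] [((0 : Fin 1), true), (0, true)] (id : Fin 2 → Fin 2) / 2 =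
      ((m : ℤ) - 1) * (n - 1) := by
    simp [twiceExponent, swapLabels]
    rw [mul_comm ((n : ℤ) - 1), ← two_mul, Int.mul_ediv_cancel_left _ two_ne_zero]
  have hamp (x : Fin 2 → ℕ) (h0 : x 0 < m) (h1 : x 1 < n) :
      amplitude ![m, n] [((0 : Fin 1), true), (0, true)] (id : Fin 2 → Fin 2) x x =
        ∑ p ∈ Finset.range n, ∑ q ∈ Finset.range m,
          posCrossing m n (x 0) (x 1) p q * posCrossing n m p q (x 0) (x 1) := by
    have hx (p q p' q' : ℕ) : Function.update (Function.update (Function.update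
        (Function.update x 0 p) 1 q) 0 p') 1 q' = x ↔ p' = x 0 ∧ q' = x 1 := by
      simp [funext_iff, Fin.forall_fin_two]
    simp [amplitude, swapLabels, crossing, hx, ite_and, h0, h1]
  rw [VH, coloredJones, hexp]
  congr 1
  rw [← Finset.sum_product']
  refine Finset.sum_nbij' (fun x => (x 0, x 1)) (fun y => ![y.1, y.2]) ?_ ?_ ?_ ?_ ?_
  · simp [Fin.forall_fin_two]
  · simp [Fin.forall_fin_two]
  · simp [funext_iff, Fin.forall_fin_two]
  · simp
  · intro x hx
    simp only [Fintype.mem_piFinset, Finset.mem_range] at hx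
    rw [hamp x (hx 0) (hx 1), Fin.prod_univ_two]
    rfl

theorem coeffE_mul_coeffF (m i k : ℕ) (hk : k ≤ i) :
    brace 1 ^ k * brace 1 ^ k * coeffE m i k * coeffF (i - k) k = weight m i k := by
  have h : coeffF (i - k) k = ∏ l ∈ Finset.range k, qint ((i : ℤ) - l) := by
    rw [coeffF, ← Finset.prod_range_reflect]
    refine Finset.prod_congr rfl fun l hl => ?_
    have := Finset.mem_range.1 hl
    congr 1
    omega
  rw [h, coeffE, weight]
  have hb (f : ℕ → ℤ) : ∏ l ∈ Finset.range k, brace (f l) =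
      brace 1 ^ k * ∏ l ∈ Finset.range k, qint (f l) := by
    simp_rw [fun l => (brace_one_mul_qint (f l)).symm]
    rw [Finset.prod_mul_distrib, Finset.prod_const, Finset.card_range]
  rw [Finset.prod_mul_distrib, hb, hb]
  ring

/-- The contribution of `e_i ⊗ e_j ↦ e_{j+k} ⊗ e_{i-k} ↦ e_i ⊗ e_j`. In terms of `j`, `k` and
`r = N - j - k` the power of `s` is linear in `r` and in `j`, and free of the quadratic terms
in `k`. -/
theorem posCrossing_mul_posCrossing (m N i j k r : ℕ) (hk : k ≤ i) (hN : k + j + r = N) :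
    s ^ (((m : ℤ) - 1) * N) * s ^ ((N : ℤ) - 2 * j) *
      (posCrossing m (N + 1) i j (j + k) (i - k) * posCrossing (N + 1) m (j + k) (i - k) i j) =
    weight m i k * (s ^ (((m : ℤ) - 2 * i + k) * ((r : ℤ) - j)) * (qbinom k j * qbinom k r)) := by
  have hs := s_ne_zero
  have h1 : i - (i - k) = k := by omega
  have hE : coeffE (N + 1) (j + k) k = coeffF r k := by
    refine Finset.prod_congr rfl fun l _ => ?_
    congr 1; push_cast [← hN]; ring
  have hexp : s ^ (((m : ℤ) - 1) * N) * s ^ ((N : ℤ) - 2 * j) *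
      s ^ (2 * ((j + k : ℕ) : ℤ) * ((i - k : ℕ) : ℤ) - (j + k : ℕ) * ((m : ℤ) - 1) -
        (i - k : ℕ) * (((N + 1 : ℕ) : ℤ) - 1)) *
      s ^ (2 * (i : ℤ) * j - i * (((N + 1 : ℕ) : ℤ) - 1) - j * ((m : ℤ) - 1)) *
      (s ^ k.choose 2 * s ^ k.choose 2) = s ^ (((m : ℤ) - 2 * i + k) * ((r : ℤ) - j)) := by
    have hc : s ^ k.choose 2 * s ^ k.choose 2 = s ^ ((k : ℤ) * (k - 1)) := by
      rw [← pow_add, ← two_mul, mul_comm 2, Nat.choose_two_right,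
        Nat.div_mul_cancel (Nat.even_mul_pred_self k).two_dvd, ← zpow_natCast]
      congr 1
      cases k <;> simp
    rw [hc]
    simp only [← zpow_add₀ hs]
    congr 1
    push_cast [← hN, hk]
    ring
  rw [posCrossing, posCrossing, if_pos (by omega), if_pos (by omega), h1,
    Nat.add_sub_cancel_left, ← coeffE_mul_coeffF m i k hk, hE, qbinom, qbinom, ← hexp]
  ring

/-- The partial trace over `V_{N+1}` of the double braiding is the same scalar at each basis vector
`e_i` of `V_m`. -/
theorem sum_posCrossing (m N i : ℕ) (hi : i < m) :
    ∑ j ∈ Finset.range (N + 1), s ^ (((m : ℤ) - 1) * N) * s ^ ((N : ℤ) - 2 * j) *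
        ∑ p ∈ Finset.range (N + 1), ∑ q ∈ Finset.range m,
          posCrossing m (N + 1) i j p q * posCrossing (N + 1) m p q i j =
      PowerSeries.coeff N (pairSeries m 0) := by
  -- Conservation of weight leaves at most one value of `q`.
  have hq (j p : ℕ) : ∑ q ∈ Finset.range m,
      posCrossing m (N + 1) i j p q * posCrossing (N + 1) m p q i j =
      if j ≤ p ∧ p - j ≤ i then posCrossing m (N + 1) i j p (i - (p - j)) *
        posCrossing (N + 1) m p (i - (p - j)) i j else 0 := by
    split_ifs with h
    · refine Finset.sum_eq_single_of_mem _ (Finset.mem_range.2 (by omega)) fun q _ hne => ?_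
      rw [posCrossing, if_neg (by omega), zero_mul]
    · refine Finset.sum_eq_zero fun q _ => ?_
      rw [posCrossing, if_neg (by omega), zero_mul]
  have hc (k : ℕ) : PowerSeries.coeff N (PowerSeries.C (weight m i k) * PowerSeries.X ^ k *
      pairSeries ((m : ℤ) - 2 * i) k) =
      if k ≤ N then ∑ x ∈ Finset.HasAntidiagonal.antidiagonal (N - k),
        weight m i k * (s ^ (((m : ℤ) - 2 * i + k) * ((x.2 : ℤ) - x.1)) *
          (qbinom k x.1 * qbinom k x.2)) else 0 := by
    rw [mul_assoc, PowerSeries.coeff_C_mul, PowerSeries.coeff_X_pow_mul', coeff_pairSeries]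
    split_ifs
    · rw [Finset.mul_sum]
    · rw [mul_zero]
  rw [← sum_weight_pairSeries m i, map_sum]
  simp only [hq, hc, Finset.mul_sum]
  rw [← Finset.sum_product', ← Finset.sum_filter, Finset.sum_sigma']
  simp only [mul_ite, mul_zero]
  rw [← Finset.sum_filter]
  -- The pair `(j, p)` corresponds to `k = p - j` and `r = N - p`.
  refine Finset.sum_nbij' (fun x => ⟨x.2 - x.1, (x.1, N - x.2)⟩)
    (fun y => (y.2.1, y.2.1 + y.1)) ?_ ?_ ?_ ?_ ?_
  · rintro ⟨j, p⟩ h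
    simp only [Finset.mem_filter, Finset.mem_product, Finset.mem_range, Finset.mem_sigma,
      Finset.HasAntidiagonal.mem_antidiagonal] at h ⊢
    omega
  · rintro ⟨k, j, r⟩ h
    simp only [Finset.mem_filter, Finset.mem_product, Finset.mem_range, Finset.mem_sigma,
      Finset.HasAntidiagonal.mem_antidiagonal] at h ⊢
    omega
  · rintro ⟨j, p⟩ h
    simp only [Finset.mem_filter, Finset.mem_product, Finset.mem_range] at h
    exact Prod.ext rfl (Nat.add_sub_cancel' h.2.1)
  · rintro ⟨k, j, r⟩ h
    simp only [Finset.mem_filter, Finset.mem_range, Finset.mem_sigma,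
      Finset.HasAntidiagonal.mem_antidiagonal] at h ⊢
    obtain rfl : r = N - (j + k) := by omega
    rw [Nat.add_sub_cancel_left]
  · rintro ⟨j, p⟩ h
    simp only [Finset.mem_filter, Finset.mem_product, Finset.mem_range] at h ⊢
    obtain ⟨k, rfl⟩ := Nat.exists_eq_add_of_le h.2.1
    rw [Nat.add_sub_cancel_left] at h ⊢
    exact posCrossing_mul_posCrossing m N i j k _ h.2.2 (by omega)

theorem VH_eq_qint (m n : ℕ) : VH m n = qint (m * n) := by
  rw [VH_eq_sum]
  rcases n with _ | N
  · simp [qint, brace]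
  rw [← sum_mul_coeff_pairSeries, Finset.sum_mul, Finset.mul_sum]
  refine Finset.sum_congr rfl fun i hi => ?_
  rw [← sum_posCrossing m N i (Finset.mem_range.1 hi), Finset.mul_sum, Finset.mul_sum]
  refine Finset.sum_congr rfl fun j _ => ?_
  push_cast
  rw [add_sub_cancel_right]
  ring

/-! ### Operators as sums of monomials -/

theorem smul_coeff (g : ShiftMonoid) (p : Coeff) : g • p = shift g.toAdd.1 g.toAdd.2 p := rfl

theorem act_add (P P' : QAlg) (V : ℕ → ℕ → K) : act (P + P') V = act P V + act P' V := by
  ext m n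
  exact SkewMonoidAlgebra.sum_add_index' (by simp) (by simp [add_mul])

theorem act_single (g : ShiftMonoid) (p : Coeff) (V : ℕ → ℕ → K) (m n : ℕ) :
    act (SkewMonoidAlgebra.single g p) V m n =
      evalCoeff m n p * V (m + g.toAdd.1) (n + g.toAdd.2) :=
  SkewMonoidAlgebra.sum_single_index (by simp)

theorem act_sub (P P' : QAlg) (V : ℕ → ℕ → K) : act (P - P') V = act P V - act P' V := by
  rw [eq_sub_iff_add_eq, ← act_add, sub_add_cancel]

/-- Coefficients stand to the left of the shift operators, so no substitution takes place. -/
theorem ofCoeff_mul_single (p r : Coeff) (g : ShiftMonoid) :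
    ofCoeff p * SkewMonoidAlgebra.single g r = SkewMonoidAlgebra.single g (p * r) := by
  rw [ofCoeff, SkewMonoidAlgebra.single_mul_single, one_mul, one_smul]

theorem AHm_eq : AHm = SkewMonoidAlgebra.single (.ofAdd (2, 0)) 1 -
    SkewMonoidAlgebra.single (.ofAdd (1, 0)) ((Qn : Coeff) + ((Qn⁻¹ : Coeffˣ) : Coeff)) +
    SkewMonoidAlgebra.single 1 1 := by
  rw [AHm, sq, Em, ofCoeff_mul_single, SkewMonoidAlgebra.single_mul_single, smul_one, mul_one,
    mul_one, SkewMonoidAlgebra.one_def]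
  rfl

theorem AHn_eq : AHn = SkewMonoidAlgebra.single (.ofAdd (0, 2)) 1 -
    SkewMonoidAlgebra.single (.ofAdd (0, 1)) ((Qm : Coeff) + ((Qm⁻¹ : Coeffˣ) : Coeff)) +
    SkewMonoidAlgebra.single 1 1 := by
  rw [AHn, sq, En, ofCoeff_mul_single, SkewMonoidAlgebra.single_mul_single, smul_one, mul_one,
    mul_one, SkewMonoidAlgebra.one_def]
  rfl

/-- The coefficient `x - x⁻¹`, whose image in the algebra of operators is `a x`. -/
def aCoeff (x : Coeffˣ) : Coeff := x - ((x⁻¹ : Coeffˣ) : Coeff)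

theorem AHbi_eq : AHbi = SkewMonoidAlgebra.single (.ofAdd (1, 0)) (aCoeff Qm) -
    SkewMonoidAlgebra.single (.ofAdd (0, 1)) (aCoeff Qn) +
    SkewMonoidAlgebra.single 1 (aCoeff (Qn * Qm⁻¹)) := by
  rw [AHbi, a, a, a, Em, En, ofCoeff_mul_single, ofCoeff_mul_single, mul_one, mul_one]
  rfl

/-! ### The annihilators -/

theorem evalCoeff_single (m n : ℕ) (v : ℤ × ℤ) (u : K) :
    evalCoeff m n (AddMonoidAlgebra.single v u) = u * s ^ ((m : ℤ) * v.1 + n * v.2) := by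
  simp [evalCoeff, AddMonoidAlgebra.lift_single]

theorem evalCoeff_Qm (m n : ℕ) : evalCoeff m n Qm = s ^ m := by
  simp [Qm, monomialUnit, evalCoeff_single]

theorem evalCoeff_Qn (m n : ℕ) : evalCoeff m n Qn = s ^ n := by
  simp [Qn, monomialUnit, evalCoeff_single]

theorem evalCoeff_inv (m n : ℕ) (x : Coeffˣ) :
    evalCoeff m n ((x⁻¹ : Coeffˣ) : Coeff) = (evalCoeff m n x)⁻¹ :=
  eq_inv_of_mul_eq_one_left (by rw [← map_mul, Units.inv_mul, map_one])

theorem qint_eq (k : ℕ) : qint k = (s ^ k - (s ^ k)⁻¹) / brace 1 := by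
  simp [qint, brace]

theorem act_AHm (V : ℕ → ℕ → K) (hV : ∀ m n : ℕ, V m n = qint ((m : ℤ) * n)) :
    act AHm V = 0 := by
  have hs := s_ne_zero
  ext m n
  rw [AHm_eq, act_add, act_sub]
  simp only [Pi.add_apply, Pi.sub_apply, act_single, map_add, map_one, evalCoeff_inv, evalCoeff_Qn,
    toAdd_ofAdd, toAdd_one, Prod.fst_zero, Prod.snd_zero, hV, ← Nat.cast_mul, qint_eq,
    Pi.zero_apply, pow_add, add_mul, two_mul, one_mul, add_zero]
  field_simp
  ring

theorem act_AHn (V : ℕ → ℕ → K) (hV : ∀ m n : ℕ, V m n = qint ((m : ℤ) * n)) :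
    act AHn V = 0 := by
  have hs := s_ne_zero
  ext m n
  rw [AHn_eq, act_add, act_sub]
  simp only [Pi.add_apply, Pi.sub_apply, act_single, map_add, map_one, evalCoeff_inv, evalCoeff_Qm,
    toAdd_ofAdd, toAdd_one, Prod.fst_zero, Prod.snd_zero, hV, ← Nat.cast_mul, qint_eq,
    Pi.zero_apply, pow_add, mul_add, one_mul, add_zero, mul_one, mul_two]
  field_simp
  ring

theorem act_AHbi (V : ℕ → ℕ → K) (hV : ∀ m n : ℕ, V m n = qint ((m : ℤ) * n)) :
    act AHbi V = 0 := by
  have hs := s_ne_zero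
  ext m n
  rw [AHbi_eq, act_add, act_sub]
  simp only [Pi.add_apply, Pi.sub_apply, act_single, aCoeff, map_sub, Units.val_mul, map_mul,
    evalCoeff_inv, evalCoeff_Qm, evalCoeff_Qn, mul_inv, inv_inv,
    toAdd_ofAdd, toAdd_one, Prod.fst_zero, Prod.snd_zero, hV, ← Nat.cast_mul, qint_eq,
    Pi.zero_apply, pow_add, add_mul, mul_add, one_mul, mul_one, add_zero]
  field_simp
  ring

/-! ### The identity between the three operators -/

theorem shift_Qm (j k : ℕ) : shift j k Qm = (sU : Coeff) ^ j * Qm := by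
  simp [Qm, sU, monomialUnit, shift_single, AddMonoidAlgebra.single_pow,
    AddMonoidAlgebra.single_mul_single]

theorem shift_Qn (j k : ℕ) : shift j k Qn = (sU : Coeff) ^ k * Qn := by
  simp [Qn, sU, monomialUnit, shift_single, AddMonoidAlgebra.single_pow,
    AddMonoidAlgebra.single_mul_single]

theorem shift_inv {j k : ℕ} {x y : Coeffˣ} (h : shift j k x = y) :
    shift j k ((x⁻¹ : Coeffˣ) : Coeff) = ((y⁻¹ : Coeffˣ) : Coeff) := by
  rw [← Units.mul_right_inj y, Units.mul_inv, ← h, ← map_mul, Units.mul_inv, map_one]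

theorem shift_aCoeff {j k : ℕ} {x y : Coeffˣ} (h : shift j k x = y) :
    shift j k (aCoeff x) = aCoeff y := by
  rw [aCoeff, aCoeff, map_sub, h, shift_inv h]

theorem aCoeff_mul_add_inv (x y : Coeffˣ) :
    aCoeff x * ((y : Coeff) + ((y⁻¹ : Coeffˣ) : Coeff)) =
      aCoeff (x * y) - aCoeff (y * x⁻¹) := by
  simp only [aCoeff, Units.val_mul, mul_inv, inv_inv]
  ring

theorem aCoeff_mul_sub_aCoeff_mul (u x y : Coeffˣ) :
    aCoeff x * aCoeff (u * x) - aCoeff y * aCoeff (u * y) =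
      -(aCoeff (u * x * y) * aCoeff (y * x⁻¹)) := by
  have hx : (x : Coeff) * ((x⁻¹ : Coeffˣ) : Coeff) = 1 := Units.mul_inv _
  have hy : (y : Coeff) * ((y⁻¹ : Coeffˣ) : Coeff) = 1 := Units.mul_inv _
  simp only [aCoeff, Units.val_mul, mul_inv, inv_inv]
  generalize ((x⁻¹ : Coeffˣ) : Coeff) = x' at *
  generalize ((y⁻¹ : Coeffˣ) : Coeff) = y' at *
  generalize ((u⁻¹ : Coeffˣ) : Coeff) = u' at *
  linear_combination (u * y ^ 2 + u' * y' ^ 2 - (u + u')) * hx -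
    (u * x ^ 2 + u' * x' ^ 2 - (u + u')) * hy

/-- The two sides agree at each of the monomials `E_m²`, `E_m E_n`, `E_n²`, `E_m`, `E_n`, `1`; at
`E_m E_n` the two terms on the right cancel. -/
theorem sub_eq_mul_AHbi : a Qm * a (sU * Qm) * AHm - a Qn * a (sU * Qn) * AHn =
    (a Qm * Em + a Qn * En - a (sU * Qm * Qn)) * AHbi := by
  have ha (x : Coeffˣ) : a x = SkewMonoidAlgebra.single 1 (aCoeff x) := rfl
  have s1 : shift 1 0 (aCoeff Qm) = aCoeff (sU * Qm) := shift_aCoeff (by simp [shift_Qm])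
  have s2 : shift 0 1 (aCoeff Qm) = aCoeff Qm := shift_aCoeff (by simp [shift_Qm])
  have s3 : shift 1 0 (aCoeff Qn) = aCoeff Qn := shift_aCoeff (by simp [shift_Qn])
  have s4 : shift 0 1 (aCoeff Qn) = aCoeff (sU * Qn) := shift_aCoeff (by simp [shift_Qn])
  have s5 : shift 1 0 (aCoeff (Qn * Qm⁻¹)) = aCoeff (Qn * (sU * Qm)⁻¹) :=
    shift_aCoeff <| by
      rw [Units.val_mul, map_mul, shift_Qn, shift_inv (y := sU * Qm) (by simp [shift_Qm])]
      simp
  have s6 : shift 0 1 (aCoeff (Qn * Qm⁻¹)) = aCoeff (sU * Qn * Qm⁻¹) :=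
    shift_aCoeff <| by
      rw [Units.val_mul, map_mul, shift_Qn, shift_inv (y := Qm) (by simp [shift_Qm])]
      simp
  have e1 : (.ofAdd (1, 0) * .ofAdd (1, 0) : ShiftMonoid) = .ofAdd (2, 0) := rfl
  have e2 : (.ofAdd (0, 1) * .ofAdd (0, 1) : ShiftMonoid) = .ofAdd (0, 2) := rfl
  have e3 : (.ofAdd (0, 1) * .ofAdd (1, 0) : ShiftMonoid) = .ofAdd (1, 1) := rfl
  have e4 : (.ofAdd (1, 0) * .ofAdd (0, 1) : ShiftMonoid) = .ofAdd (1, 1) := rfl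
  -- The coefficients of `E_m`, of `E_n` and of `1`.
  have c10 : aCoeff Qm * aCoeff (sU * Qm) * ((Qn : Coeff) + ((Qn⁻¹ : Coeffˣ) : Coeff)) =
      aCoeff (sU * Qm * Qn) * aCoeff Qm - aCoeff Qm * aCoeff (Qn * (sU * Qm)⁻¹) := by
    rw [mul_assoc, aCoeff_mul_add_inv]
    ring
  have c01 : aCoeff Qn * aCoeff (sU * Qn) * ((Qm : Coeff) + ((Qm⁻¹ : Coeffˣ) : Coeff)) =
      aCoeff (sU * Qm * Qn) * aCoeff Qn + aCoeff Qn * aCoeff (sU * Qn * Qm⁻¹) := by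
    have h := aCoeff_mul_add_inv (sU * Qn) Qm
    have h' : aCoeff (Qm * (sU * Qn)⁻¹) = -aCoeff (sU * Qn * Qm⁻¹) := by
      simp only [aCoeff, mul_inv_rev, inv_inv, neg_sub, mul_comm]
    rw [mul_assoc, h, h', mul_right_comm sU Qn Qm]
    ring
  have c00 := aCoeff_mul_sub_aCoeff_mul sU Qm Qn
  rw [sub_eq_iff_eq_add] at c00
  rw [AHm_eq, AHn_eq, AHbi_eq]
  simp only [ha, Em, En, mul_sub, mul_add, sub_mul, add_mul, SkewMonoidAlgebra.single_mul_single,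
    one_mul, mul_one, one_smul, smul_coeff, toAdd_ofAdd, e1, e2, e3, e4, s1, s2, s3, s4, s5, s6]
  rw [← mul_add, ← mul_add, c10, c01, c00, mul_comm (aCoeff Qn) (aCoeff Qm)]
  simp only [sub_eq_add_neg, SkewMonoidAlgebra.single_add, SkewMonoidAlgebra.single_neg]
  abel

end HopfAJ

end

theorem mainTheorem4 :
    (∀ m n : ℕ, HopfAJ.VH m n = HopfAJ.qint ((m : ℤ) * n)) ∧
    HopfAJ.act HopfAJ.AHm HopfAJ.VH = 0 ∧
    HopfAJ.act HopfAJ.AHn HopfAJ.VH = 0 ∧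
    HopfAJ.act HopfAJ.AHbi HopfAJ.VH = 0 ∧
    HopfAJ.a HopfAJ.Qm * HopfAJ.a (HopfAJ.sU * HopfAJ.Qm) * HopfAJ.AHm -
        HopfAJ.a HopfAJ.Qn * HopfAJ.a (HopfAJ.sU * HopfAJ.Qn) * HopfAJ.AHn =
      (HopfAJ.a HopfAJ.Qm * HopfAJ.Em + HopfAJ.a HopfAJ.Qn * HopfAJ.En -
          HopfAJ.a (HopfAJ.sU * HopfAJ.Qm * HopfAJ.Qn)) * HopfAJ.AHbi := by
  exact ⟨HopfAJ.VH_eq_qint, HopfAJ.act_AHm _ HopfAJ.VH_eq_qint,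
    HopfAJ.act_AHn _ HopfAJ.VH_eq_qint, HopfAJ.act_AHbi _ HopfAJ.VH_eq_qint,
    HopfAJ.sub_eq_mul_AHbi⟩
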